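/- Let $\mathscr{F}$ be a family of subsets of a set $X$. The comatching number $\tau(X,\mathscr{F})$ is the largest $n$ for which there are $x_1,\dots,x_n\in X$ and $F_1,\dots,F_n\in\mathscr{F}$ such that $x_i\in F_j$ if and only if $i\neq j$, and $\tau'(X,\mathscr{F})$ is the largest $n$ for which there are $x_1,\dots,x_{n+1}\in X$ and $F_1,\dots,F_n\in\mathscr{F}$ such that $x_i\in F_j$ if and only if $i\neq j$. The nerve complex $N(\mathscr{F})$ is the abstract simplicial complex on the vertex set $\mathscr{F}$ whose faces are the finite subfamilies of $\mathscr{F}$ with non-empty intersection. An abstract simplicial complex $K$ is $k$-Leray if $\tilde H_i(L;\mathbb{R})=0$ for every induced subcomplex $L$ of $K$ and every $i\ge k$. It is $k$-collapsible if all faces with at least $k$ vertices can be removed by a finite sequence of $k$-collapses, where a $k$-collapse removes a face $\sigma$ with exactly $k$ vertices that is contained in a unique maximal face, together with all faces containing $\sigma$. For every integer $d\ge 1$ there exist a finite set $X$ and a family $\mathscr{F}$ of subsets of $X$ with $$\tau'(X,\mathscr{F})\le\tau(X,\mathscr{F})\le 2d$$ such that $N(\mathscr{F})$ is not $(3d-1)$-Leray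 and not $(3d-1)$-collapsible. -/

import Mathlib

/-! ### Comatchings of a set family -/

/-- Points `x i` and members `F i` of `𝓕` form a comatching of size `n` when `x i ∈ F j` exactly
for `i ≠ j`: the pairs `(x i, F i)` are then the edges of an induced matching of size `n` in the
bipartite graph on `X ⊔ 𝓕` in which `x` and `F` are adjacent iff `x ∉ F`. (The points, and
likewise the sets, are automatically pairwise distinct.) -/
def IsComatching {X : Type*} (𝓕 : Set (Set X)) {n : ℕ} (x : Fin n → X) (F : Fin n → Set X) :
    Prop :=
  (∀ j, F j ∈ 𝓕) ∧ ∀ i j, x i ∈ F j ↔ i ≠ j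

/-- A comatching of size `n` together with one more point, the last one, lying in all the sets. -/
def IsComatchingWithIntersection {X : Type*} (𝓕 : Set (Set X)) {n : ℕ} (x : Fin (n + 1) → X)
    (F : Fin n → Set X) : Prop :=
  (∀ j, F j ∈ 𝓕) ∧ ∀ i j, x i ∈ F j ↔ i ≠ j.castSucc

/-- The comatching number `τ(X, 𝓕)`, the largest size of a comatching (`⊤` if unbounded). -/
noncomputable def comatchingNumber {X : Type*} (𝓕 : Set (Set X)) : ℕ∞ :=
  sSup {m : ℕ∞ | ∃ n : ℕ, m = n ∧ ∃ (x : Fin n → X) (F : Fin n → Set X), IsComatching 𝓕 x F}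

/-- The number `τ'(X, 𝓕)`, the largest size of a comatching with intersection
(`⊤` if unbounded). -/
noncomputable def comatchingNumberWithIntersection {X : Type*} (𝓕 : Set (Set X)) : ℕ∞ :=
  sSup {m : ℕ∞ | ∃ n : ℕ, m = n ∧ ∃ (x : Fin (n + 1) → X) (F : Fin n → Set X),
    IsComatchingWithIntersection 𝓕 x F}

/-! ### Simplicial complexes

Mathlib's `PreAbstractSimplicialComplex V` lists the nonempty faces only; the empty face is
understood to be present as well. -/

/-- The nerve complex of a set family, on the vertex set `𝓕`: the faces are the (finite, nonempty)
subfamilies with nonempty intersection. -/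
def nerveComplex {X : Type*} (𝓕 : Set (Set X)) : PreAbstractSimplicialComplex 𝓕 where
  faces := {σ | σ.Nonempty ∧ ∃ x : X, ∀ F ∈ σ, x ∈ (F : Set X)}
  isRelLowerSet_faces := fun {_} hσ =>
    ⟨hσ.1, fun _ hτσ hτ => ⟨hτ, hσ.2.imp fun _ hx F hF => hx F (hτσ hF)⟩⟩

namespace PreAbstractSimplicialComplex

/-- The induced subcomplex of `K` on the vertex set `W`. -/
def induced {V : Type*} (K : PreAbstractSimplicialComplex V) (W : Set V) :
    PreAbstractSimplicialComplex V where
  faces := {σ | σ ∈ K.faces ∧ ↑σ ⊆ W}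
  isRelLowerSet_faces := fun {_} hσ =>
    ⟨(K.isRelLowerSet_faces hσ.1).1, fun _ hτσ hτ =>
      ⟨(K.isRelLowerSet_faces hσ.1).2 hτσ hτ, (Finset.coe_subset.2 hτσ).trans hσ.2⟩⟩

/-! #### Collapsibility -/

/-- `L` arises from `K` by a `d`-collapse: for some free face `σ` with `d` vertices, i.e. a face
contained in exactly one maximal face, `σ` and all faces containing it are removed. -/
def IsElementaryCollapse {V : Type*} (d : ℕ) (K L : PreAbstractSimplicialComplex V) : Prop :=
  ∃ σ ∈ K.faces, σ.card = d ∧ (∃! τ : Finset V, Maximal (· ∈ K.faces) τ ∧ σ ⊆ τ) ∧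
    L.faces = {τ | τ ∈ K.faces ∧ ¬ σ ⊆ τ}

/-- `K` is `d`-collapsible: a finite sequence of `d`-collapses removes all faces with at least
`d` vertices. -/
def IsCollapsible {V : Type*} (K : PreAbstractSimplicialComplex V) (d : ℕ) : Prop :=
  ∃ L : PreAbstractSimplicialComplex V,
    Relation.ReflTransGen (IsElementaryCollapse d) K L ∧ ∀ σ ∈ L.faces, σ.card < d

/-! #### Reduced simplicial homology with real coefficients -/

/-- The real chains of `K` supported on faces with `n` vertices (dimension `n - 1`), as finitely
supported functions on finite vertex sets. For `n = 0` this is spanned by the empty face. -/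
noncomputable def chains {V : Type*} (K : PreAbstractSimplicialComplex V) (n : ℕ) :
    Submodule ℝ (Finset V →₀ ℝ) :=
  Finsupp.supported ℝ ℝ {σ | (σ ∈ K.faces ∨ σ = ∅) ∧ σ.card = n}

/-- The simplicial boundary map, every simplex being oriented by a linear order of the vertices:
`∂ {v₀ < ⋯ < vₙ} = ∑ₖ (-1) ^ k {v₀, …, vₙ} \ {vₖ}`. The boundary of a vertex is the empty
face. -/
noncomputable def boundary (V : Type*) [LinearOrder V] :
    (Finset V →₀ ℝ) →ₗ[ℝ] (Finset V →₀ ℝ) :=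
  Finsupp.linearCombination ℝ fun σ : Finset V =>
    ∑ v ∈ σ, Finsupp.single (σ.erase v) ((-1 : ℝ) ^ (σ.filter (· < v)).card)

/-- The reduced `i`-cycles. -/
noncomputable def cycles {V : Type*} [LinearOrder V] (K : PreAbstractSimplicialComplex V)
    (i : ℕ) : Submodule ℝ (Finset V →₀ ℝ) :=
  K.chains (i + 1) ⊓ LinearMap.ker (boundary V)

/-- The `i`-boundaries. -/
noncomputable def boundaries {V : Type*} [LinearOrder V] (K : PreAbstractSimplicialComplex V)
    (i : ℕ) : Submodule ℝ (Finset V →₀ ℝ) :=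
  (K.chains (i + 2)).map (boundary V)

/-- The boundary of a boundary vanishes. -/
theorem boundary_boundary {V : Type*} [LinearOrder V] (c : Finset V →₀ ℝ) :
    boundary V (boundary V c) = 0 := by
  suffices h : (boundary V).comp (boundary V) = 0 from LinearMap.congr_fun h c
  refine Finsupp.lhom_ext' fun σ => LinearMap.ext_ring ?_
  have key : ∀ v ∈ σ, ∀ w ∈ σ, v < w →
      (-1 : ℝ) ^ (σ.filter (· < v)).card * (-1 : ℝ) ^ ((σ.erase v).filter (· < w)).card =
      - ((-1 : ℝ) ^ (σ.filter (· < w)).card * (-1 : ℝ) ^ ((σ.erase w).filter (· < v)).card) := by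
    intro v hv w hw hvw
    have h1 : (σ.erase w).filter (· < v) = σ.filter (· < v) := by
      ext u
      simp only [Finset.mem_filter, Finset.mem_erase]
      exact ⟨fun h => ⟨h.1.2, h.2⟩, fun h => ⟨⟨(h.2.trans hvw).ne, h.1⟩, h.2⟩⟩
    have h2 : (σ.erase v).filter (· < w) = (σ.filter (· < w)).erase v := by
      rw [Finset.filter_erase]
    have h3 : ((σ.filter (· < w)).erase v).card + 1 = (σ.filter (· < w)).card :=
      Finset.card_erase_add_one (Finset.mem_filter.2 ⟨hv, hvw⟩)
    rw [h1, h2, ← h3, pow_succ]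
    ring
  simp only [LinearMap.comp_apply, Finsupp.lsingle_apply, boundary,
    Finsupp.linearCombination_single, one_smul, map_sum, LinearMap.zero_apply, Finset.smul_sum,
    Finsupp.smul_single, smul_eq_mul]
  rw [Finset.sum_sigma']
  refine Finset.sum_involution (fun p _ => ⟨p.2, p.1⟩) ?_ ?_ ?_ ?_
  · rintro ⟨v, w⟩ h
    simp only [Finset.mem_sigma, Finset.mem_erase] at h
    obtain ⟨hv, hwv, hw⟩ := h
    simp only
    rw [Finset.erase_right_comm, ← Finsupp.single_add, Finsupp.single_eq_zero]
    rcases lt_or_gt_of_ne hwv with hlt | hlt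
    · rw [key w hw v hv hlt]; ring
    · rw [key v hv w hw hlt]; ring
  · rintro ⟨v, w⟩ h _ heq
    simp only [Finset.mem_sigma, Finset.mem_erase] at h
    simp only [Sigma.mk.injEq] at heq
    exact h.2.1 heq.1
  · rintro ⟨v, w⟩ h
    simp only [Finset.mem_sigma, Finset.mem_erase] at h ⊢
    exact ⟨h.2.2, h.2.1.symm, h.1⟩
  · rintro ⟨v, w⟩ h
    rfl

/-- The boundary of a chain of `K` is a chain of `K`. -/
theorem boundary_mem_chains {V : Type*} [LinearOrder V] (K : PreAbstractSimplicialComplex V)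
    {n : ℕ} {c : Finset V →₀ ℝ} (hc : c ∈ K.chains (n + 1)) : boundary V c ∈ K.chains n := by
  rw [boundary, Finsupp.linearCombination_apply]
  refine Submodule.sum_mem _ fun σ hσ => Submodule.smul_mem _ _ (Submodule.sum_mem _ fun v hv => ?_)
  refine Finsupp.single_mem_supported ℝ _ ?_
  obtain ⟨hK, hcard⟩ := (Finsupp.mem_supported ℝ c).1 hc hσ
  refine ⟨?_, by rw [Finset.card_erase_of_mem hv, hcard]; rfl⟩
  rcases hK with hK | rfl
  · rcases (σ.erase v).eq_empty_or_nonempty with h | h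
    · exact Or.inr h
    · exact Or.inl ((K.isRelLowerSet_faces hK).2 (Finset.erase_subset v σ) h)
  · simp at hv

theorem boundaries_le_cycles {V : Type*} [LinearOrder V] (K : PreAbstractSimplicialComplex V)
    (i : ℕ) : K.boundaries i ≤ K.cycles i := by
  rintro _ ⟨c, hc, rfl⟩
  exact ⟨K.boundary_mem_chains hc, boundary_boundary c⟩

/-- The reduced homology group `H̃ᵢ(K; ℝ)`, the cycles modulo the boundaries, realized as the image
of the space of cycles in the quotient of the space of all chains by the boundaries. -/
noncomputable def reducedHomology {V : Type*} [LinearOrder V]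
    (K : PreAbstractSimplicialComplex V) (i : ℕ) :
    Submodule ℝ ((Finset V →₀ ℝ) ⧸ K.boundaries i) :=
  (K.cycles i).map (K.boundaries i).mkQ

theorem reducedHomology_eq_bot_iff {V : Type*} [LinearOrder V]
    (K : PreAbstractSimplicialComplex V) (i : ℕ) :
    K.reducedHomology i = ⊥ ↔ K.cycles i ≤ K.boundaries i := by
  rw [reducedHomology, eq_bot_iff, Submodule.map_le_iff_le_comap]
  exact iff_of_eq (congrArg _ (Submodule.ker_mkQ _))

/-- Whether the reduced homology vanishes does not depend on the order of the vertices. -/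
theorem reducedHomology_eq_bot_of_order {V : Type*} (K : PreAbstractSimplicialComplex V) (i : ℕ)
    (o₁ o₂ : LinearOrder V) (h : @reducedHomology V o₁ K i = ⊥) :
    @reducedHomology V o₂ K i = ⊥ := by
  classical
  let inv : Finset V → ℕ := fun σ =>
    ∑ p ∈ σ, ∑ q ∈ σ, if o₁.lt p q ∧ o₂.lt q p then 1 else 0
  have hprop : ∀ (p₁ q₁ p₂ q₂ : Prop) [Decidable p₁] [Decidable q₁] [Decidable p₂] [Decidable q₂],
      (p₁ ∨ q₁) → (p₂ ∨ q₂) → (p₁ → ¬ q₁) → (p₂ → ¬ q₂) →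
      (if q₁ ∧ p₂ then 1 else 0) + (if p₁ ∧ q₂ then 1 else 0) + (if p₂ then 1 else 0) =
        (if p₁ then 1 else 0) + 2 * (if q₁ ∧ p₂ then 1 else 0) := by
    intro p₁ q₁ p₂ q₂ _ _ _ _ a1 a2 b1 b2
    by_cases p₁ <;> by_cases p₂ <;> simp_all
  have hsgn : ∀ (σ : Finset V), ∀ v ∈ σ,
      (-1 : ℝ) ^ inv σ * (-1 : ℝ) ^ (σ.filter (o₂.lt · v)).card =
      (-1 : ℝ) ^ (σ.filter (o₁.lt · v)).card * (-1 : ℝ) ^ inv (σ.erase v) := by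
    intro σ v hv
    obtain ⟨e, hve, rfl⟩ : ∃ e, v ∉ e ∧ insert v e = σ :=
      ⟨σ.erase v, Finset.notMem_erase v σ, Finset.insert_erase hv⟩
    have h1 : ¬ o₁.lt v v := @lt_irrefl V o₁.toPreorder v
    have h2 : ¬ o₂.lt v v := @lt_irrefl V o₂.toPreorder v
    have hpt : ∀ u ∈ e,
        (if o₁.lt v u ∧ o₂.lt u v then 1 else 0) + (if o₁.lt u v ∧ o₂.lt v u then 1 else 0) +
        (if o₂.lt u v then 1 else 0) = (if o₁.lt u v then 1 else 0) +
        2 * (if o₁.lt v u ∧ o₂.lt u v then 1 else 0) := by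
      intro u hu
      have huv : u ≠ v := fun h => hve (h ▸ hu)
      have a1 : o₁.lt u v ∨ o₁.lt v u := @lt_or_gt_of_ne V o₁ u v huv
      have a2 : o₂.lt u v ∨ o₂.lt v u := @lt_or_gt_of_ne V o₂ u v huv
      have b1 : o₁.lt u v → ¬ o₁.lt v u := @lt_asymm V o₁.toPreorder u v
      have b2 : o₂.lt u v → ¬ o₂.lt v u := @lt_asymm V o₂.toPreorder u v
      exact hprop _ _ _ _ a1 a2 b1 b2
    have hsum := Finset.sum_congr (rfl : e = e) hpt
    simp only [Finset.sum_add_distrib, ← Finset.mul_sum] at hsum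
    rw [← pow_add, ← pow_add, Finset.erase_insert hve, Finset.card_filter, Finset.card_filter]
    have hinv : inv (insert v e) + ∑ u ∈ insert v e, (if o₂.lt u v then 1 else 0) =
        (∑ u ∈ insert v e, (if o₁.lt u v then 1 else 0)) + inv e +
        2 * ∑ u ∈ e, (if o₁.lt v u ∧ o₂.lt u v then 1 else 0) := by
      simp only [inv, Finset.sum_insert hve, Finset.sum_add_distrib, h1, h2, false_and, if_false]
      omega
    rw [hinv, pow_add _ _ (2 * _), pow_mul]
    simp
  let T : (Finset V →₀ ℝ) →ₗ[ℝ] (Finset V →₀ ℝ) :=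
    Finsupp.linearCombination ℝ fun σ => Finsupp.single σ ((-1 : ℝ) ^ inv σ)
  have hT : ∀ σ (r : ℝ), T (Finsupp.single σ r) = Finsupp.single σ (r * (-1 : ℝ) ^ inv σ) := by
    intro σ r
    simp [T, Finsupp.linearCombination_single]
  have hTT : ∀ c, T (T c) = c := by
    suffices hh : T.comp T = LinearMap.id from fun c => LinearMap.congr_fun hh c
    refine Finsupp.lhom_ext' fun σ => LinearMap.ext_ring ?_
    simp only [LinearMap.comp_apply, Finsupp.lsingle_apply, hT, LinearMap.id_apply]
    rw [mul_assoc, ← pow_add, ← two_mul, pow_mul]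
    simp
  have hTK : ∀ n, ∀ c ∈ K.chains n, T c ∈ K.chains n := by
    intro n c hc
    simp only [T, Finsupp.linearCombination_apply]
    exact Submodule.sum_mem _ fun σ hσ => Submodule.smul_mem _ _
      (Finsupp.single_mem_supported ℝ _ ((Finsupp.mem_supported ℝ c).1 hc hσ))
  have hb : ∀ (o : LinearOrder V) (σ : Finset V) (r : ℝ),
      @boundary V o (Finsupp.single σ r) =
        ∑ v ∈ σ, Finsupp.single (σ.erase v) (r * (-1 : ℝ) ^ (σ.filter (o.lt · v)).card) := by
    intro o σ r
    simp only [boundary, Finsupp.linearCombination_single, Finset.smul_sum, Finsupp.smul_single,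
      smul_eq_mul]
  have hcomm : ∀ c, @boundary V o₂ (T c) = T (@boundary V o₁ c) := by
    suffices hh : (@boundary V o₂).comp T = T.comp (@boundary V o₁) from
      fun c => LinearMap.congr_fun hh c
    refine Finsupp.lhom_ext' fun σ => LinearMap.ext_ring ?_
    simp only [LinearMap.comp_apply, Finsupp.lsingle_apply, hT, hb, map_sum, one_mul]
    exact Finset.sum_congr rfl fun v hv => by rw [hsgn σ v hv]; congr!
  rw [@reducedHomology_eq_bot_iff V o₁] at h
  rw [@reducedHomology_eq_bot_iff V o₂]
  rintro c ⟨hc, hc0⟩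
  have hTc : T c ∈ @cycles V o₁ K i := by
    refine ⟨hTK _ c hc, ?_⟩
    have h0 : @boundary V o₂ c = 0 := hc0
    have h1 := hcomm (T c)
    rw [hTT, h0] at h1
    have h2 := congrArg T h1
    rw [hTT, map_zero] at h2
    exact h2.symm
  obtain ⟨b, hbK, hbc⟩ := h hTc
  exact ⟨T b, hTK _ b hbK, by rw [hcomm, hbc, hTT]⟩

/-- `K` is `d`-Leray: `H̃ᵢ(L; ℝ) = 0` for every induced subcomplex `L` of `K` and all `i ≥ d`.
The linear order serves only to orient the simplices: whether the homology vanishes does not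
depend on it, by `reducedHomology_eq_bot_of_order`. -/
def IsLeray {V : Type*} (K : PreAbstractSimplicialComplex V) (d : ℕ) : Prop :=
  ∀ (_ : LinearOrder V) (W : Set V) (i : ℕ), d ≤ i → (K.induced W).reducedHomology i = ⊥

end PreAbstractSimplicialComplex

namespace PreAbstractSimplicialComplex

/-! ### Boundary coefficients and detecting homology by a cocycle -/

section Homology

variable {V : Type*} [LinearOrder V]

/-! The ground example is the case of one factor: the sixteen two-by-two squares in the discrete
torus of side 4. The four squares whose corners bound a unit cell share a point, so the nerve of the
squares contains the triangulated torus on their corners; its fundamental cycle stays nontrivial in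
the nerve, where it pairs to a nonzero number with an explicit cocycle (`torusCocycle_cocycle`,
`torusCocycle_pairing`). Thus there is homology in dimension 2. Yet no three squares form a
comatching (`torusSquare_no_comatching`): of three pairwise intersecting arcs of length two in the
cyclic group of order 4, two coincide, and applying this in both coordinates makes one of the three
squares contain the intersection of the other two.

Now take the `d`-th power of the torus as `X`, with the cylinders over squares in one coordinate as
family. Points in different coordinates are chosen independently, so the nerve is the join of `d`
copies of the ground nerve. Products of the cycles and of the cocycles are again a cycle and a
cocycle, and their pairing is a product, so homology survives on faces with `3 * d` vertices, in
dimension `3 * d - 1`. By pigeonhole a comatching with more than `2 * d` sets would use three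
cylinders over the same coordinate, hence yield a comatching of three squares.

The homology class refutes the Leray property on the whole complex. It also refutes collapsibility,
since a `d`-collapse cannot destroy homology in dimension `d`
(`IsElementaryCollapse.cycles_le_boundaries`). -/

theorem boundary_single (σ : Finset V) (r : ℝ) :
    boundary V (Finsupp.single σ r) =
      ∑ v ∈ σ, Finsupp.single (σ.erase v) (r * (-1 : ℝ) ^ (σ.filter (· < v)).card) := by
  simp only [boundary, Finsupp.linearCombination_single, Finset.smul_sum, Finsupp.smul_single,
    smul_eq_mul]

/-- The coefficient of a boundary at a face. -/
theorem boundary_apply [Fintype V] (c : Finset V →₀ ℝ) (ρ : Finset V) :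
    boundary V c ρ = ∑ v ∈ ρᶜ, (-1 : ℝ) ^ (ρ.filter (· < v)).card * c (insert v ρ) := by
  induction c using Finsupp.induction_linear with
  | zero => simp
  | add f g hf hg => simp only [map_add, Finsupp.add_apply, hf, hg, mul_add, Finset.sum_add_distrib]
  | single σ r =>
    rw [boundary_single, Finsupp.finsetSum_apply]
    simp only [Finsupp.single_apply]
    rw [← Finset.sum_filter_ne_zero, ← Finset.sum_filter_ne_zero (s := ρᶜ)]
    refine Finset.sum_congr ?_ ?_
    · ext v
      simp only [Finset.mem_filter, Finset.mem_compl, ne_eq, ite_eq_right_iff, not_forall,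
        mul_eq_zero, pow_eq_zero_iff', neg_eq_zero, one_ne_zero, false_and, false_or, or_false]
      constructor
      · rintro ⟨hv, rfl, hr⟩
        exact ⟨Finset.notMem_erase v σ, (Finset.insert_erase hv).symm, hr⟩
      · rintro ⟨hv, rfl, hr⟩
        exact ⟨Finset.mem_insert_self v ρ, Finset.erase_insert hv, hr⟩
    · intro v hv
      simp only [Finset.mem_filter, Finset.mem_compl, ne_eq, mul_eq_zero, not_or,
        ite_eq_right_iff, not_forall] at hv
      obtain ⟨hvρ, -, rfl, -⟩ := hv
      rw [if_pos (Finset.erase_insert hvρ), if_pos rfl, Finset.filter_insert,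
        if_neg (lt_irrefl v), mul_comm]

/-- A cycle that pairs nontrivially with a cocycle is not a boundary. -/
theorem not_cycles_le_boundaries_of_pairing [Fintype V] {K : PreAbstractSimplicialComplex V}
    {i : ℕ} {z : Finset V →₀ ℝ} (hz : z ∈ K.cycles i) (φ : Finset V → ℝ)
    (hφ : ∀ σ ∈ K.faces, ∑ v ∈ σ, (-1 : ℝ) ^ (σ.filter (· < v)).card * φ (σ.erase v) = 0)
    (hne : ∑ σ, φ σ * z σ ≠ 0) : ¬ K.cycles i ≤ K.boundaries i := by
  intro hle
  obtain ⟨b, hb, rfl⟩ := hle hz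
  apply hne
  obtain ⟨p, hps, hp⟩ : ∃ p : (Finset V →₀ ℝ) →ₗ[ℝ] ℝ,
      (∀ σ r, p (Finsupp.single σ r) = r * φ σ) ∧ ∀ c, p c = ∑ σ, φ σ * c σ := by
    refine ⟨Finsupp.linearCombination ℝ φ, fun σ r => by simp, fun c => ?_⟩
    rw [Finsupp.linearCombination_apply, Finsupp.sum_fintype _ _ (by simp)]
    exact Finset.sum_congr rfl fun σ _ => mul_comm _ _
  -- By linearity it suffices to pair `φ` with the boundary of a single face, where the cocycle
  -- condition applies.
  rw [← hp, boundary, Finsupp.linearCombination_apply, Finsupp.sum, map_sum]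
  refine Finset.sum_eq_zero fun σ hσ => ?_
  obtain ⟨hK, hcard⟩ := (Finsupp.mem_supported ℝ b).1 hb hσ
  have hσK : σ ∈ K.faces := hK.resolve_right fun h => by simp [h] at hcard
  rw [map_smul, map_sum, Finset.sum_congr rfl, hφ σ hσK, smul_zero]
  exact fun v _ => hps _ _

end Homology

/-! ### Collapses and homology -/

section Collapse

variable {V : Type*} [LinearOrder V]

/-- A `d`-collapse does not kill homology in dimension `d`. -/
theorem IsElementaryCollapse.cycles_le_boundaries [Finite V] {d : ℕ}
    {K L : PreAbstractSimplicialComplex V} (h : IsElementaryCollapse d K L)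
    (hL : L.cycles d ≤ L.boundaries d) : K.cycles d ≤ K.boundaries d := by
  classical
  have := Fintype.ofFinite V
  obtain ⟨σ, hσK, hσd, ⟨τ, ⟨hτ, hστ⟩, huniq⟩, hLK⟩ := h
  have hsub : ∀ n, L.chains n ≤ K.chains n := fun n => by
    refine Finsupp.supported_mono ?_
    rintro ρ ⟨hρ, hn⟩
    rw [hLK] at hρ
    exact ⟨hρ.imp_left And.left, hn⟩
  have hbsub : L.boundaries d ≤ K.boundaries d := Submodule.map_mono (hsub _)
  have hle : ∀ ρ ∈ K.faces, σ ⊆ ρ → ρ ⊆ τ := by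
    intro ρ hρ hσρ
    obtain ⟨m, hm, hmax⟩ := (Set.toFinite K.faces).exists_le_maximal hρ
    rw [← huniq m ⟨hmax, hσρ.trans hm⟩]
    exact hm
  have hout : ∀ c ∈ K.cycles d, (∀ ρ, σ ⊆ ρ → c ρ = 0) → c ∈ K.boundaries d := by
    rintro c ⟨hc, hc0⟩ hσ
    refine hbsub (hL ⟨?_, hc0⟩)
    refine (Finsupp.mem_supported ℝ c).2 fun ρ hρ => ?_
    obtain ⟨h1, h2⟩ := (Finsupp.mem_supported ℝ c).1 hc hρ
    refine ⟨h1.imp_left fun h => ?_, h2⟩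
    rw [hLK]
    exact ⟨h, fun hs => (Finsupp.mem_support_iff.1 hρ) (hσ ρ hs)⟩
  rintro c hc
  obtain ⟨hcK, hc0⟩ := hc
  have hface : ∀ ρ, c ρ ≠ 0 → ρ ∈ K.faces ∧ ρ.card = d + 1 := fun ρ hρ => by
    obtain ⟨h1, h2⟩ := (Finsupp.mem_supported ℝ c).1 hcK (Finsupp.mem_support_iff.2 hρ)
    exact ⟨h1.resolve_right fun h => by simp [h] at h2, h2⟩
  -- If `σ` is itself maximal, every face containing it has only `d` vertices, so a `d`-chain,
  -- supported on `d + 1` vertices, already avoids it.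
  by_cases hστ' : τ ⊆ σ
  · refine hout c ⟨hcK, hc0⟩ fun ρ hρ => ?_
    by_contra hne
    obtain ⟨h1, h2⟩ := hface ρ hne
    have := Finset.card_le_card ((hle ρ h1 hρ).trans hστ')
    omega
  obtain ⟨v, hvτ, hvσ⟩ := Finset.not_subset.1 hστ'
  -- Otherwise the faces containing `σ` all lie in `τ`, so those without `v` can be coned off from
  -- `v` inside `K`. The chain `b` is this cone over the part of `c` on faces that contain `σ` but
  -- not `v`; subtracting its boundary pushes `c` into `L`.
  let g : Finset V → ℝ := fun ρ =>
    if v ∈ ρ ∧ σ ⊆ ρ.erase v then (-1 : ℝ) ^ (ρ.filter (· < v)).card * c (ρ.erase v) else 0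
  let b : Finset V →₀ ℝ := Finsupp.equivFunOnFinite.symm g
  have hb : b ∈ K.chains (d + 2) := by
    refine (Finsupp.mem_supported ℝ b).2 fun ρ hρ => ?_
    have hρ' : g ρ ≠ 0 := Finsupp.mem_support_iff.1 hρ
    simp only [g, ne_eq, ite_eq_right_iff, not_forall, mul_eq_zero, not_or] at hρ'
    obtain ⟨⟨hvρ, hσρ⟩, -, hcρ⟩ := hρ'
    obtain ⟨h1, h2⟩ := hface _ hcρ
    refine ⟨Or.inl ?_, ?_⟩
    · refine (K.isRelLowerSet_faces hτ.1).2 ?_ ⟨v, hvρ⟩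
      rw [← Finset.insert_erase hvρ]
      exact Finset.insert_subset hvτ (hle _ h1 hσρ)
    · rw [← Finset.card_erase_add_one hvρ, h2]
  set c' := c - boundary V b with hc'
  have hc'0 : boundary V c' = 0 := by
    rw [hc', map_sub, boundary_boundary, sub_zero]; exact hc0
  -- At a face without `v`, the only coface on which `b` can be nonzero is the one obtained by
  -- adding `v`, and its sign is chosen to reproduce `c ρ`.
  have key : ∀ ρ, σ ⊆ ρ → v ∉ ρ → c' ρ = 0 := by
    intro ρ hσρ hvρ
    rw [hc', Finsupp.sub_apply, boundary_apply, Finset.sum_eq_single v]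
    · have : b (insert v ρ) = (-1 : ℝ) ^ (ρ.filter (· < v)).card * c ρ := by
        change g _ = _
        simp only [g]
        rw [Finset.erase_insert hvρ, if_pos ⟨Finset.mem_insert_self v ρ, hσρ⟩,
          Finset.filter_insert, if_neg (lt_irrefl v)]
      rw [this, ← mul_assoc, ← pow_add, ← two_mul, pow_mul]
      simp
    · intro w _ hwv
      have : b (insert w ρ) = 0 := by
        change g _ = _
        simp only [g]
        rw [if_neg]
        rintro ⟨h, -⟩
        rcases Finset.mem_insert.1 h with h | h
        exacts [hwv h.symm, hvρ h]
      rw [this, mul_zero]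
    · intro h
      exact absurd (Finset.mem_compl.2 hvρ) h
  have key2 : ∀ ρ, σ ⊆ ρ → c' ρ = 0 := by
    intro ρ hσρ
    by_cases hvρ : v ∈ ρ
    -- In the vanishing coefficient of the boundary of `c'` at `ρ.erase v`, every other coface
    -- contains `σ` but not `v` and drops out by `key`, which forces `c' ρ = 0`.
    · have h0 := boundary_apply c' (ρ.erase v)
      have hσe : σ ⊆ ρ.erase v := Finset.subset_erase.2 ⟨hσρ, hvσ⟩
      rw [hc'0, Finset.sum_eq_single v, Finset.insert_erase hvρ] at h0
      · simpa using h0.symm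
      · intro w _ hwv
        rw [key _ (hσe.trans (Finset.subset_insert _ _)), mul_zero]
        simp [hwv.symm]
      · intro h
        simp at h
    · exact key ρ hσρ hvρ
  have hmem : c' ∈ K.boundaries d :=
    hout c' ⟨Submodule.sub_mem _ hcK (K.boundary_mem_chains hb), hc'0⟩ key2
  have : c = c' + boundary V b := by rw [hc', sub_add_cancel]
  rw [this]
  exact Submodule.add_mem _ hmem ⟨b, hb, rfl⟩

/-- A `d`-collapsible complex has no homology in dimension `d`. -/
theorem IsCollapsible.cycles_le_boundaries [Finite V] {d : ℕ}
    {K : PreAbstractSimplicialComplex V} (h : K.IsCollapsible d) :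
    K.cycles d ≤ K.boundaries d := by
  obtain ⟨L, hKL, hL⟩ := h
  induction hKL using Relation.ReflTransGen.head_induction_on with
  | refl =>
    rintro c ⟨hc, -⟩
    have : c = 0 := by
      refine Finsupp.support_eq_empty.1 (Finset.eq_empty_of_forall_notMem fun ρ hρ => ?_)
      obtain ⟨h1, h2⟩ := (Finsupp.mem_supported ℝ c).1 hc hρ
      rcases h1 with h1 | rfl
      · have := hL ρ h1
        omega
      · simp at h2
    rw [this]
    exact Submodule.zero_mem _
  | head hstep _ ih => exact hstep.cycles_le_boundaries ih

end Collapse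

end PreAbstractSimplicialComplex

namespace PreAbstractSimplicialComplex

/-! ### Products of cycles and cocycles on joins -/

section Join

set_option linter.unusedSectionVars false

variable {κ V₀ V : Type*}

/-- The part of a set of vertices of a join that lies in one of the joined vertex sets. -/
def slice [Fintype V₀] [DecidableEq V] (e : κ × V₀ ≃ V) (σ : Finset V) (k : κ) : Finset V₀ :=
  Finset.univ.filter fun p => e (k, p) ∈ σ

theorem mem_slice [Fintype V₀] [DecidableEq V] {e : κ × V₀ ≃ V} {σ : Finset V} {k : κ} {p : V₀} :
    p ∈ slice e σ k ↔ e (k, p) ∈ σ := by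
  simp [slice]

variable [Fintype κ] [Fintype V₀] [Fintype V] [LinearOrder κ] [LinearOrder V₀] [LinearOrder V]

theorem slice_injective (e : κ × V₀ ≃ V) {σ τ : Finset V} (h : ∀ k, slice e σ k = slice e τ k) :
    σ = τ := by
  ext v
  obtain ⟨⟨k, p⟩, rfl⟩ := e.surjective v
  rw [← mem_slice, h, mem_slice]

theorem sum_join (e : κ × V₀ ≃ V) {M : Type*} [AddCommMonoid M] (σ : Finset V) (f : V → M) :
    ∑ v ∈ σ, f v = ∑ k, ∑ p ∈ slice e σ k, f (e (k, p)) := by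
  simp only [slice, Finset.sum_filter]
  rw [← Fintype.sum_prod_type' fun k p => if e (k, p) ∈ σ then f (e (k, p)) else 0,
    e.sum_comp fun v => if v ∈ σ then f v else 0, Finset.sum_ite_mem, Finset.univ_inter]

theorem card_eq_sum_slice (e : κ × V₀ ≃ V) (σ : Finset V) :
    σ.card = ∑ k, (slice e σ k).card := by
  simp only [Finset.card_eq_sum_ones]
  exact sum_join e σ _

theorem slice_insert (e : κ × V₀ ≃ V) (σ : Finset V) (k : κ) (p : V₀) :
    slice e (insert (e (k, p)) σ) = Function.update (slice e σ) k (insert p (slice e σ k)) := by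
  ext j q
  rcases eq_or_ne j k with rfl | h
  · simp [mem_slice]
  · simp [mem_slice, h]

theorem slice_erase (e : κ × V₀ ≃ V) (σ : Finset V) (k : κ) (p : V₀) :
    slice e (σ.erase (e (k, p))) = Function.update (slice e σ) k ((slice e σ k).erase p) := by
  ext j q
  rcases eq_or_ne j k with rfl | h
  · simp [mem_slice]
  · simp [mem_slice, h]

theorem slice_compl (e : κ × V₀ ≃ V) (σ : Finset V) (k : κ) :
    slice e σᶜ k = (slice e σ k)ᶜ := by
  ext q
  simp [mem_slice]

/-- In the block-by-block order, the sign of a vertex splits into a factor depending only on the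
earlier blocks and the sign inside its own block. This is what lets the products below dispense with
Koszul signs. -/
theorem card_filter_lt_join {e : κ × V₀ ≃ V}
    (he : ∀ a b, e a < e b ↔ a.1 < b.1 ∨ a.1 = b.1 ∧ a.2 < b.2) (σ : Finset V) (k : κ) (p : V₀) :
    (σ.filter (· < e (k, p))).card =
      ∑ j with j < k, (slice e σ j).card + ((slice e σ k).filter (· < p)).card := by
  have h : ∀ j, (slice e (σ.filter (· < e (k, p))) j).card =
      (if j < k then (slice e σ j).card else 0) +
        (if j = k then ((slice e σ k).filter (· < p)).card else 0) := by
    intro j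
    rcases lt_trichotomy j k with hj | rfl | hj
    · rw [if_pos hj, if_neg hj.ne, add_zero]
      congr 1
      ext q
      simp [mem_slice, he, hj]
    · rw [if_neg (lt_irrefl j), if_pos rfl, zero_add]
      congr 1
      ext q
      simp [mem_slice, he]
    · rw [if_neg hj.not_gt, if_neg hj.ne', add_zero, Finset.card_eq_zero]
      ext q
      simp [mem_slice, he, hj.not_gt, hj.ne']
  rw [card_eq_sum_slice e]
  simp only [h, Finset.sum_add_distrib, Finset.sum_ite_eq', Finset.mem_univ, if_true,
    Finset.sum_filter]

/-- The product of copies of one cochain, on the join of copies of one complex. -/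
def joinCochain (e : κ × V₀ ≃ V) (f : Finset V₀ → ℝ) (σ : Finset V) : ℝ :=
  ∏ k, f (slice e σ k)

theorem joinCochain_of_update {e : κ × V₀ ≃ V} (f : Finset V₀ → ℝ) {σ τ : Finset V} {k : κ}
    {s : Finset V₀} (h : slice e τ = Function.update (slice e σ) k s) :
    joinCochain e f τ = (∏ j ∈ Finset.univ.erase k, f (slice e σ j)) * f s := by
  rw [joinCochain, h, ← Finset.prod_erase_mul _ _ (Finset.mem_univ k), Function.update_self]
  congr 1
  refine Finset.prod_congr rfl fun j hj => ?_
  rw [Function.update_of_ne (Finset.ne_of_mem_erase hj)]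

/-- The product of cycles is a cycle. -/
theorem joinCochain_cycle {e : κ × V₀ ≃ V}
    (he : ∀ a b, e a < e b ↔ a.1 < b.1 ∨ a.1 = b.1 ∧ a.2 < b.2) {z : Finset V₀ → ℝ}
    (hz : ∀ ρ, ∑ v ∈ ρᶜ, (-1 : ℝ) ^ (ρ.filter (· < v)).card * z (insert v ρ) = 0)
    (ρ : Finset V) :
    ∑ v ∈ ρᶜ, (-1 : ℝ) ^ (ρ.filter (· < v)).card * joinCochain e z (insert v ρ) = 0 := by
  rw [sum_join e]
  refine Finset.sum_eq_zero fun k _ => ?_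
  -- The contribution of block `k` is a constant times the boundary coefficient of `z` at the slice,
  -- so each block vanishes on its own.
  simp only [joinCochain_of_update z (slice_insert e ρ k _), card_filter_lt_join he, slice_compl]
  have := congrArg (((-1 : ℝ) ^ (∑ j with j < k, (slice e ρ j).card) *
    ∏ j ∈ Finset.univ.erase k, z (slice e ρ j)) * ·) (hz (slice e ρ k))
  simp only [mul_zero, Finset.mul_sum] at this
  rw [← this]
  exact Finset.sum_congr rfl fun p _ => by rw [pow_add]; ring

/-- The product of cocycles is a cocycle. -/
theorem joinCochain_cocycle {e : κ × V₀ ≃ V}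
    (he : ∀ a b, e a < e b ↔ a.1 < b.1 ∨ a.1 = b.1 ∧ a.2 < b.2) {φ : Finset V₀ → ℝ}
    {σ : Finset V}
    (hφ : ∀ k, ∑ v ∈ slice e σ k, (-1 : ℝ) ^ ((slice e σ k).filter (· < v)).card *
      φ ((slice e σ k).erase v) = 0) :
    ∑ v ∈ σ, (-1 : ℝ) ^ (σ.filter (· < v)).card * joinCochain e φ (σ.erase v) = 0 := by
  rw [sum_join e]
  refine Finset.sum_eq_zero fun k _ => ?_
  simp only [joinCochain_of_update φ (slice_erase e σ k _), card_filter_lt_join he]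
  have := congrArg (((-1 : ℝ) ^ (∑ j with j < k, (slice e σ j).card) *
    ∏ j ∈ Finset.univ.erase k, φ (slice e σ j)) * ·) (hφ k)
  simp only [mul_zero, Finset.mul_sum] at this
  rw [← this]
  exact Finset.sum_congr rfl fun p _ => by rw [pow_add]; ring

/-- If exactly one face contributes to the pairing of `φ` and `z`, then the products of copies of
`φ` and `z` pair nontrivially. -/
theorem joinCochain_pairing_ne_zero (e : κ × V₀ ≃ V) {φ z : Finset V₀ → ℝ} {t : Finset V₀}
    (ht : φ t * z t ≠ 0) (h : ∀ s, s ≠ t → φ s * z s = 0) :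
    ∑ σ, joinCochain e φ σ * joinCochain e z σ ≠ 0 := by
  have hs : ∀ k, slice e (Finset.univ.filter fun v => (e.symm v).2 ∈ t) k = t := fun k => by
    ext p
    simp [mem_slice]
  -- The surviving face is the one with slice `t` in every block.
  rw [Finset.sum_eq_single (Finset.univ.filter fun v => (e.symm v).2 ∈ t)]
  · simp only [joinCochain, hs, ← Finset.prod_mul_distrib]
    exact Finset.prod_ne_zero_iff.2 fun _ _ => ht
  · intro σ _ hσ
    rw [joinCochain, joinCochain, ← Finset.prod_mul_distrib, Finset.prod_eq_zero_iff]
    by_contra hne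
    push Not at hne
    refine hσ (slice_injective e fun k => ?_)
    rw [hs]
    by_contra hk
    exact hne k (Finset.mem_univ k) (h _ hk)
  · exact fun h => absurd (Finset.mem_univ _) h

end Join

end PreAbstractSimplicialComplex

namespace PreAbstractSimplicialComplex

/-! ### Simplices with orientation independent of the vertex order -/

section Oriented

variable {V : Type*} [LinearOrder V]

/-- The sign of an ordered pair. -/
noncomputable def pairSign (a b : V) : ℝ := if a < b then 1 else -1

/-- The oriented edge from `a` to `b`, as a chain. -/
noncomputable def orientedEdge (a b : V) : Finset V →₀ ℝ := Finsupp.single {a, b} (pairSign a b)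

/-- The oriented triangle with vertices `a`, `b`, `c`, as a chain. -/
noncomputable def orientedTriangle (a b c : V) : Finset V →₀ ℝ :=
  Finsupp.single {a, b, c} (pairSign a b * pairSign b c * pairSign a c)

theorem pairSign_mul_self (a b : V) : pairSign a b * pairSign a b = 1 := by
  unfold pairSign
  split_ifs <;> norm_num

/-- The sign in `orientedTriangle` is that of the permutation sorting the vertices, so the usual
formula holds for vertices listed in any order. This spares a case distinction where the torus wraps
around. -/
theorem boundary_orientedTriangle {a b c : V} (hab : a ≠ b) (hbc : b ≠ c) (hac : a ≠ c) :
    boundary V (orientedTriangle a b c) =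
      orientedEdge b c - orientedEdge a c + orientedEdge a b := by
  have hlt : ∀ {u v : V}, u ≠ v → (-1 : ℝ) ^ (if u < v then 1 else 0) = -pairSign u v := by
    intro u v _
    unfold pairSign
    split_ifs <;> norm_num
  have hgt : ∀ {u v : V}, u ≠ v → (-1 : ℝ) ^ (if v < u then 1 else 0) = pairSign u v := by
    intro u v h
    unfold pairSign
    rcases lt_or_gt_of_ne h with h | h
    · simp [h, h.not_gt]
    · simp [h, h.not_gt]
  have hcard : ∀ v : V, (({a, b, c} : Finset V).filter (· < v)).card =
      (if a < v then 1 else 0) + ((if b < v then 1 else 0) + (if c < v then 1 else 0)) := by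
    intro v
    rw [Finset.card_filter, Finset.sum_insert (by simp [hab, hac]), Finset.sum_pair hbc]
  have ha : ({a, b, c} : Finset V).erase a = {b, c} := by
    ext u; simp only [Finset.mem_erase, Finset.mem_insert, Finset.mem_singleton]; grind
  have hb : ({a, b, c} : Finset V).erase b = {a, c} := by
    ext u; simp only [Finset.mem_erase, Finset.mem_insert, Finset.mem_singleton]; grind
  have hc : ({a, b, c} : Finset V).erase c = {a, b} := by
    ext u; simp only [Finset.mem_erase, Finset.mem_insert, Finset.mem_singleton]; grind
  rw [orientedTriangle, boundary_single, Finset.sum_insert (by simp [hab, hac]),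
    Finset.sum_pair hbc]
  simp only [hcard, pow_add, lt_irrefl, if_false, pow_zero, one_mul, mul_one, ha, hb, hc]
  rw [hgt hab, hgt hac, hlt hab, hgt hbc, hlt hac, hlt hbc]
  have h1 := pairSign_mul_self a b
  have h2 := pairSign_mul_self b c
  have h3 := pairSign_mul_self a c
  rw [orientedEdge, orientedEdge, orientedEdge, sub_eq_add_neg, ← Finsupp.single_neg, add_assoc]
  refine congrArg₂ (· + ·) (congrArg _ ?_) (congrArg₂ (· + ·) (congrArg _ ?_) (congrArg _ ?_))
  · linear_combination pairSign b c * pairSign a c * pairSign a c * h1 + pairSign b c * h3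
  · linear_combination -pairSign a c * pairSign b c * pairSign b c * h1 - pairSign a c * h2
  · linear_combination pairSign a b * pairSign b c * pairSign b c * h3 + pairSign a b * h2

end Oriented

/-! ### The torus and its two-by-two squares -/

section Torus

/-- The vertices of a grid of four by four squares on the torus. -/
abbrev TorusVertex : Type := Fin 4 ×ₗ Fin 4

/-- The vertex with given coordinates. -/
abbrev torusVertex (i j : Fin 4) : TorusVertex := toLex (i, j)

/-- The arc consisting of two consecutive points of the cyclic group of order four. -/
def arc (i : Fin 4) : Set (Fin 4) := {x | x = i ∨ x = i + 1}

/-- The square of side two with a given corner, in the four by four torus. -/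
def torusSquare (p : TorusVertex) : Set (Fin 4 × Fin 4) := arc (ofLex p).1 ×ˢ arc (ofLex p).2

/-- The fundamental cycle of the torus. -/
noncomputable def torusCycle : Finset TorusVertex →₀ ℝ :=
  ∑ i, ∑ j,
    (orientedTriangle (torusVertex i j) (torusVertex (i + 1) j) (torusVertex (i + 1) (j + 1)) -
      orientedTriangle (torusVertex i j) (torusVertex i (j + 1)) (torusVertex (i + 1) (j + 1)))

theorem torusVertex_ne {i j i' j' : Fin 4} (h : i ≠ i' ∨ j ≠ j') :
    torusVertex i j ≠ torusVertex i' j' := by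
  intro heq
  have := toLex.injective heq
  rw [Prod.mk.injEq] at this
  tauto

theorem boundary_torusCycle : boundary TorusVertex torusCycle = 0 := by
  have h1 : ∀ i : Fin 4, i ≠ i + 1 := by decide
  -- The diagonals of the two triangles cancel. What remains are differences of opposite sides of
  -- the cell, whose sums vanish by translation invariance.
  have hb : ∀ i j : Fin 4, boundary TorusVertex
      (orientedTriangle (torusVertex i j) (torusVertex (i + 1) j) (torusVertex (i + 1) (j + 1)) -
      orientedTriangle (torusVertex i j) (torusVertex i (j + 1)) (torusVertex (i + 1) (j + 1))) =
      (orientedEdge (torusVertex (i + 1) j) (torusVertex (i + 1) (j + 1)) -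
        orientedEdge (torusVertex i j) (torusVertex i (j + 1))) -
      (orientedEdge (torusVertex i (j + 1)) (torusVertex (i + 1) (j + 1)) -
        orientedEdge (torusVertex i j) (torusVertex (i + 1) j)) := by
    intro i j
    rw [map_sub, boundary_orientedTriangle (torusVertex_ne (Or.inl (h1 i)))
      (torusVertex_ne (Or.inr (h1 j))) (torusVertex_ne (Or.inl (h1 i))),
      boundary_orientedTriangle (torusVertex_ne (Or.inr (h1 j)))
      (torusVertex_ne (Or.inl (h1 i))) (torusVertex_ne (Or.inl (h1 i)))]
    abel
  have h2 : ∀ (f : Fin 4 → Finset TorusVertex →₀ ℝ), ∑ i, f (i + 1) = ∑ i, f i :=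
    fun f => Equiv.sum_comp (Equiv.addRight (1 : Fin 4)) f
  rw [torusCycle, map_sum]
  simp only [map_sum, hb]
  simp only [Finset.sum_sub_distrib]
  rw [h2 fun i => ∑ j, orientedEdge (torusVertex i j) (torusVertex i (j + 1)), sub_self, zero_sub,
    neg_eq_zero, sub_eq_zero]
  exact Finset.sum_congr rfl fun i _ =>
    h2 fun j => orientedEdge (torusVertex i j) (torusVertex (i + 1) j)

theorem torusCycle_apply (σ : Finset TorusVertex) : torusCycle σ = ∑ i, ∑ j,
    (orientedTriangle (torusVertex i j) (torusVertex (i + 1) j) (torusVertex (i + 1) (j + 1)) σ -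
      orientedTriangle (torusVertex i j) (torusVertex i (j + 1)) (torusVertex (i + 1) (j + 1))
        σ) := by
  simp [torusCycle]

theorem exists_of_torusCycle_ne_zero {σ : Finset TorusVertex} (h : torusCycle σ ≠ 0) :
    ∃ i j, σ = {torusVertex i j, torusVertex (i + 1) j, torusVertex (i + 1) (j + 1)} ∨
      σ = {torusVertex i j, torusVertex i (j + 1), torusVertex (i + 1) (j + 1)} := by
  by_contra! hne
  apply h
  rw [torusCycle_apply]
  refine Finset.sum_eq_zero fun i _ => Finset.sum_eq_zero fun j _ => ?_
  rw [orientedTriangle, orientedTriangle, Finsupp.single_apply, Finsupp.single_apply,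
    if_neg (hne i j).1.symm, if_neg (hne i j).2.symm, sub_zero]

theorem card_of_torusCycle_ne_zero {σ : Finset TorusVertex} (h : torusCycle σ ≠ 0) :
    σ.card = 3 := by
  obtain ⟨i, j, rfl | rfl⟩ := exists_of_torusCycle_ne_zero h
  all_goals
    clear h
    revert i j
    decide

/-- The point `(i + 1, j + 1)` lies in all four squares with corners at the vertices of the cell
`(i, j)`, so the triangles of the torus are faces of the nerve. -/
theorem exists_mem_of_torusCycle_ne_zero {σ : Finset TorusVertex} (h : torusCycle σ ≠ 0) :
    ∃ x, ∀ p ∈ σ, x ∈ torusSquare p := by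
  obtain ⟨i, j, rfl | rfl⟩ := exists_of_torusCycle_ne_zero h <;>
  exact ⟨(i + 1, j + 1), by simp [torusSquare, arc]⟩

/-- A cocycle on the nerve of the squares, dual to the fundamental cycle of the torus. -/
noncomputable def torusCocycle (σ : Finset TorusVertex) : ℝ :=
  if σ = {torusVertex 0 1, torusVertex 1 0, torusVertex 1 1} ∨
    σ = {torusVertex 0 0, torusVertex 1 0, torusVertex 1 1} then 1 else 0

theorem torusCocycle_pairing : torusCocycle {torusVertex 0 0, torusVertex 1 0, torusVertex 1 1} *
    torusCycle {torusVertex 0 0, torusVertex 1 0, torusVertex 1 1} ≠ 0 := by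
  have h1 : ∀ i j : Fin 4,
      ({torusVertex i j, torusVertex (i + 1) j, torusVertex (i + 1) (j + 1)} : Finset TorusVertex) =
      {torusVertex 0 0, torusVertex 1 0, torusVertex 1 1} ↔ i = 0 ∧ j = 0 := by decide
  have h2 : ∀ i j : Fin 4,
      ({torusVertex i j, torusVertex i (j + 1), torusVertex (i + 1) (j + 1)} : Finset TorusVertex) ≠
      {torusVertex 0 0, torusVertex 1 0, torusVertex 1 1} := by decide
  rw [torusCocycle, if_pos (Or.inr rfl), one_mul, torusCycle_apply]
  simp only [orientedTriangle, Finsupp.single_apply, h1, h2, if_false, sub_zero]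
  rw [Finset.sum_eq_single 0 (fun i _ hi => by simp [hi]) (by simp),
    Finset.sum_eq_single 0 (fun i _ hi => by simp [hi]) (by simp)]
  simp only [and_self, if_true, pairSign]
  split_ifs <;> norm_num

/-- The second triangle in the support of the cocycle uses the antidiagonal of its cell, whereas the
triangulation uses only diagonals. -/
theorem torusCocycle_mul_torusCycle_eq_zero {σ : Finset TorusVertex}
    (h : σ ≠ {torusVertex 0 0, torusVertex 1 0, torusVertex 1 1}) :
    torusCocycle σ * torusCycle σ = 0 := by
  rw [torusCocycle]
  split_ifs with hσ
  · rw [or_iff_left h] at hσ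
    subst hσ
    by_contra hne
    obtain ⟨i, j, h⟩ := exists_of_torusCycle_ne_zero (right_ne_zero_of_mul hne)
    clear hne
    revert i j
    decide
  · rw [zero_mul]

/-- Each triangle in the support of the cocycle has `(1, 1)` as the only common point of its
squares, so the only face with one more vertex containing it consists of all four squares through
that point. In this tetrahedron the two triangles are opposite to neighbouring vertices in the
order, so their signs cancel. -/
theorem torusCocycle_cocycle {σ : Finset TorusVertex} {x : Fin 4 × Fin 4}
    (hx : ∀ p ∈ σ, x ∈ torusSquare p) :
    ∑ v ∈ σ, (-1 : ℝ) ^ (σ.filter (· < v)).card * torusCocycle (σ.erase v) = 0 := by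
  by_cases h : ∃ v ∈ σ, torusCocycle (σ.erase v) ≠ 0
  · obtain ⟨v, hv, hne⟩ := h
    simp only [torusCocycle, ne_eq, ite_eq_right_iff, one_ne_zero, imp_false, not_not] at hne
    have hcard : σ.card = 4 := by
      rw [← Finset.card_erase_add_one hv]
      rcases hne with hne | hne <;> rw [hne] <;> rfl
    have hx1 : x = (1, 1) := by
      have hmem : ∀ p ∈ σ.erase v, x ∈ torusSquare p := fun p hp => hx p (Finset.mem_of_mem_erase hp)
      clear hx
      obtain ⟨x, y⟩ := x
      rcases hne with hne | hne <;>
      · simp [hne, torusSquare, arc] at hmem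
        revert x y
        decide
    have hσ : σ = {torusVertex 0 0, torusVertex 0 1, torusVertex 1 0, torusVertex 1 1} := by
      refine Finset.eq_of_subset_of_card_le ?_ (by rw [hcard]; decide)
      intro p hp
      have := hx p hp
      rw [hx1] at this
      clear hp
      simp only [torusSquare, arc, Set.mem_prod, Set.mem_ofPred_eq] at this
      revert p
      decide
    subst hσ
    have e1 : (({torusVertex 0 0, torusVertex 0 1, torusVertex 1 0, torusVertex 1 1} :
        Finset TorusVertex).filter (· < torusVertex 0 0)).card = 0 := by decide
    have e2 : (({torusVertex 0 0, torusVertex 0 1, torusVertex 1 0, torusVertex 1 1} :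
        Finset TorusVertex).filter (· < torusVertex 0 1)).card = 1 := by decide
    rw [Finset.sum_insert (by decide), Finset.sum_insert (by decide), Finset.sum_pair (by decide),
      e1, e2]
    have c1 : torusCocycle (({torusVertex 0 0, torusVertex 0 1, torusVertex 1 0, torusVertex 1 1} :
        Finset TorusVertex).erase (torusVertex 0 0)) = 1 := if_pos (by decide)
    have c2 : torusCocycle (({torusVertex 0 0, torusVertex 0 1, torusVertex 1 0, torusVertex 1 1} :
        Finset TorusVertex).erase (torusVertex 0 1)) = 1 := if_pos (by decide)
    have c3 : torusCocycle (({torusVertex 0 0, torusVertex 0 1, torusVertex 1 0, torusVertex 1 1} :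
        Finset TorusVertex).erase (torusVertex 1 0)) = 0 := if_neg (by decide)
    have c4 : torusCocycle (({torusVertex 0 0, torusVertex 0 1, torusVertex 1 0, torusVertex 1 1} :
        Finset TorusVertex).erase (torusVertex 1 1)) = 0 := if_neg (by decide)
    rw [c1, c2, c3, c4]
    norm_num
  · push Not at h
    exact Finset.sum_eq_zero fun v hv => by rw [h v hv, mul_zero]

/-- Three squares do not form a comatching. -/
theorem torusSquare_no_comatching {p q r : TorusVertex} {x y z : Fin 4 × Fin 4}
    (hxp : x ∉ torusSquare p) (hxq : x ∈ torusSquare q) (hxr : x ∈ torusSquare r)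
    (hyp : y ∈ torusSquare p) (hyq : y ∉ torusSquare q) (hyr : y ∈ torusSquare r)
    (hzp : z ∈ torusSquare p) (hzq : z ∈ torusSquare q) (hzr : z ∉ torusSquare r) : False := by
  -- Three distinct arcs out of the four include two opposite ones, which are disjoint.
  have key : ∀ i j k : Fin 4, (∃ x, x ∈ arc j ∧ x ∈ arc k) → (∃ x, x ∈ arc i ∧ x ∈ arc k) →
      (∃ x, x ∈ arc i ∧ x ∈ arc j) → i = j ∨ i = k ∨ j = k := by
    simp only [arc, Set.mem_ofPred_eq]
    decide
  simp only [torusSquare, Set.mem_prod] at *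
  have h1 := key _ _ _ ⟨_, hxq.1, hxr.1⟩ ⟨_, hyp.1, hyr.1⟩ ⟨_, hzp.1, hzq.1⟩
  have h2 := key _ _ _ ⟨_, hxq.2, hxr.2⟩ ⟨_, hyp.2, hyr.2⟩ ⟨_, hzp.2, hzq.2⟩
  -- If the same pair agrees in both coordinates, two squares coincide. Otherwise the square common
  -- to the two pairs contains the intersection of the other two. Both contradict the comatching.
  rcases h1 with h1 | h1 | h1 <;> rcases h2 with h2 | h2 | h2 <;>
    simp only [h1, h2] at * <;> tauto

theorem torusSquare_injective : Function.Injective torusSquare := by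
  have harc : Function.Injective arc := by
    intro i j h
    have h1 : ∀ x, (x = i ∨ x = i + 1) ↔ (x = j ∨ x = j + 1) := fun x => Set.ext_iff.1 h x
    clear h
    revert i j
    decide
  intro p q h
  have hne : ∀ i, (arc i).Nonempty := fun i => ⟨i, Or.inl rfl⟩
  rcases Set.prod_eq_prod_iff.1 h with ⟨h1, h2⟩ | ⟨h1, -⟩
  · exact ofLex.injective (Prod.ext (harc h1) (harc h2))
  · rcases h1 with h1 | h1
    · exact absurd h1 (hne _).ne_empty
    · exact absurd h1 (hne _).ne_empty

end Torus

end PreAbstractSimplicialComplex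

/-! ### Cylinders in a power of the torus, and the theorem -/

open PreAbstractSimplicialComplex

/-- The set of the points of a power of the torus one coordinate of which lies in a given square. -/
def squareCylinder {κ : Type*} (a : κ × TorusVertex) : Set (κ → Fin 4 × Fin 4) :=
  {x | x a.1 ∈ torusSquare a.2}

theorem mem_squareCylinder {κ : Type*} {a : κ × TorusVertex} {x : κ → Fin 4 × Fin 4} :
    x ∈ squareCylinder a ↔ x a.1 ∈ torusSquare a.2 := Iff.rfl

/-- The family is a set, so injectivity is what makes the vertices of its nerve correspond to pairs
of a coordinate and a square. -/
theorem squareCylinder_injective {κ : Type*} :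
    Function.Injective (squareCylinder : κ × TorusVertex → Set (κ → Fin 4 × Fin 4)) := by
  classical
  have hmem : ∀ p : TorusVertex, ofLex p ∈ torusSquare p := fun p => ⟨Or.inl rfl, Or.inl rfl⟩
  have hnot : ∀ p : TorusVertex, ((ofLex p).1 + 2, (ofLex p).2) ∉ torusSquare p := by
    have h2 : ∀ i : Fin 4, ¬ (i + 2 = i ∨ i + 2 = i + 1) := by decide
    exact fun p h => h2 _ h.1
  rintro ⟨k, p⟩ ⟨l, q⟩ h
  obtain rfl : k = l := by
    by_contra hkl
    -- A point inside the first cylinder but outside the second: shifting by 2 leaves an arc of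
    -- length two.
    have := Set.ext_iff.1 h (Function.update (fun _ => ofLex p) l ((ofLex q).1 + 2, (ofLex q).2))
    simp only [mem_squareCylinder, Function.update_self, Function.update_of_ne hkl] at this
    exact hnot q (this.1 (hmem p))
  congr 1
  apply torusSquare_injective
  ext x
  exact Set.ext_iff.1 h fun _ => x

/-- A comatching with intersection contains a comatching of the same size. -/
theorem comatchingNumberWithIntersection_le {X : Type*} (𝓕 : Set (Set X)) :
    comatchingNumberWithIntersection 𝓕 ≤ comatchingNumber 𝓕 := by
  refine sSup_le_sSup ?_
  rintro _ ⟨n, rfl, x, F, hF, hx⟩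
  exact ⟨n, rfl, fun i => x i.castSucc, F, hF, fun i j => by
    rw [hx, ne_eq, ne_eq, Fin.castSucc_inj]⟩

theorem comatchingNumber_squareCylinder_le (d : ℕ) :
    comatchingNumber (Set.range (squareCylinder : Fin d × TorusVertex → _)) ≤
      ((2 * d : ℕ) : ℕ∞) := by
  refine sSup_le ?_
  rintro _ ⟨n, rfl, x, F, hF, hx⟩
  choose a ha using hF
  rw [Nat.cast_le]
  by_contra! hn
  -- With more than `2 * d` cylinders, three are over one coordinate `k`; membership in them depends
  -- only on the `k`-th coordinates of the points.
  obtain ⟨k, -, hk⟩ := Finset.exists_lt_card_fiber_of_mul_lt_card_of_maps_to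
    (s := (Finset.univ : Finset (Fin n))) (t := (Finset.univ : Finset (Fin d)))
    (f := fun j => (a j).1) (n := 2) (fun _ _ => Finset.mem_univ _) (by simpa [mul_comm] using hn)
  obtain ⟨i, j, l, hi, hj, hl, hij, hil, hjl⟩ := Finset.two_lt_card_iff.1 hk
  simp only [Finset.mem_filter, Finset.mem_univ, true_and] at hi hj hl
  have key : ∀ u v, (a v).1 = k → (x u k ∈ torusSquare (a v).2 ↔ u ≠ v) := by
    intro u v hv
    rw [← hx u v, ← ha v, mem_squareCylinder, hv]
  exact torusSquare_no_comatching (p := (a i).2) (q := (a j).2) (r := (a l).2)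
    (x := x i k) (y := x j k) (z := x l k)
    (by simp [key _ _ hi]) (by simp [key _ _ hj, hij]) (by simp [key _ _ hl, hil])
    (by simp [key _ _ hi, hij.symm]) (by simp [key _ _ hj]) (by simp [key _ _ hl, hjl])
    (by simp [key _ _ hi, hil.symm]) (by simp [key _ _ hj, hjl.symm]) (by simp [key _ _ hl])

/-- The join of `d` copies of the nerve of the squares of the torus has homology in dimension
`3 * d - 1`. -/
theorem not_cycles_le_boundaries_of_join_torus {d : ℕ} (hd : 1 ≤ d) {V : Type*} [LinearOrder V]
    {K : PreAbstractSimplicialComplex V} {e : Fin d × TorusVertex ≃ V}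
    (he : ∀ a b, e a < e b ↔ a.1 < b.1 ∨ a.1 = b.1 ∧ a.2 < b.2)
    (hK : ∀ σ, σ ∈ K.faces ↔ σ.Nonempty ∧ ∃ x : Fin d → Fin 4 × Fin 4,
      ∀ k p, e (k, p) ∈ σ → x k ∈ torusSquare p) :
    ¬ K.cycles (3 * d - 1) ≤ K.boundaries (3 * d - 1) := by
  have := Fintype.ofEquiv _ e
  refine not_cycles_le_boundaries_of_pairing
    (z := Finsupp.equivFunOnFinite.symm (joinCochain e torusCycle)) ⟨?_, ?_⟩
    (joinCochain e torusCocycle) ?_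
    (joinCochain_pairing_ne_zero e torusCocycle_pairing
      fun _ => torusCocycle_mul_torusCycle_eq_zero)
  · refine (Finsupp.mem_supported ℝ _).2 fun σ hσ => ?_
    have hσ' : joinCochain e torusCycle σ ≠ 0 := Finsupp.mem_support_iff.1 hσ
    have hne : ∀ k, torusCycle (slice e σ k) ≠ 0 := fun k =>
      Finset.prod_ne_zero_iff.1 hσ' k (Finset.mem_univ k)
    have hcard : σ.card = 3 * d := by
      rw [card_eq_sum_slice e, Finset.sum_congr rfl fun k _ => card_of_torusCycle_ne_zero (hne k)]
      simp [mul_comm]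
    choose x hx using fun k => exists_mem_of_torusCycle_ne_zero (hne k)
    refine ⟨Or.inl ((hK σ).2 ⟨Finset.card_pos.1 (by omega), x, fun k p hp => ?_⟩), by omega⟩
    exact hx k p (mem_slice.2 hp)
  · refine LinearMap.mem_ker.2 (Finsupp.ext fun ρ => ?_)
    rw [boundary_apply, Finsupp.zero_apply]
    refine joinCochain_cycle he (fun ρ => ?_) ρ
    rw [← boundary_apply, boundary_torusCycle, Finsupp.zero_apply]
  · intro σ hσ
    obtain ⟨-, x, hx⟩ := (hK σ).1 hσ
    exact joinCochain_cocycle he fun k => torusCocycle_cocycle (x := x k) fun p hp =>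
      hx k p (mem_slice.1 hp)

theorem mainTheorem8 (d : ℕ) (hd : 1 ≤ d) :
    ∃ (X : Type) (_ : Finite X) (𝓕 : Set (Set X)),
      comatchingNumberWithIntersection 𝓕 ≤ comatchingNumber 𝓕 ∧
      comatchingNumber 𝓕 ≤ ((2 * d : ℕ) : ℕ∞) ∧
      ¬ (nerveComplex 𝓕).IsLeray (3 * d - 1) ∧
      ¬ (nerveComplex 𝓕).IsCollapsible (3 * d - 1) := by
  let e := Equiv.ofInjective _ (squareCylinder_injective (κ := Fin d))
  -- The Leray property quantifies over all vertex orders, so one may be chosen to refute it: the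
  -- lexicographic one, coordinate first, as the sign computation on joins requires.
  let o : LinearOrder (Set.range (squareCylinder : Fin d × TorusVertex → _)) :=
    LinearOrder.lift' (fun F => toLex (e.symm F)) (toLex.injective.comp e.symm.injective)
  have he : ∀ a b, o.lt (e a) (e b) ↔ a.1 < b.1 ∨ a.1 = b.1 ∧ a.2 < b.2 := by
    intro a b
    change toLex (e.symm (e a)) < toLex (e.symm (e b)) ↔ _
    rw [e.symm_apply_apply, e.symm_apply_apply, Prod.Lex.toLex_lt_toLex]
  have hne := @not_cycles_le_boundaries_of_join_torus d hd _ o (nerveComplex _) e he fun σ =>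
    and_congr_right fun _ => exists_congr fun x =>
      ⟨fun h k p hp => h _ hp, fun h F hF => by
        obtain ⟨⟨k, p⟩, rfl⟩ := e.surjective F
        exact h k p hF⟩
  refine ⟨Fin d → Fin 4 × Fin 4, inferInstance, Set.range squareCylinder,
    comatchingNumberWithIntersection_le _, comatchingNumber_squareCylinder_le d, fun h => ?_,
    fun h => hne (@IsCollapsible.cycles_le_boundaries _ o _ _ _ h)⟩
  have h0 := (@reducedHomology_eq_bot_iff _ o _ _).1 (h o Set.univ (3 * d - 1) le_rfl)
  have huniv : (nerveComplex (Set.range (squareCylinder : Fin d × TorusVertex → _))).induced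
      Set.univ = nerveComplex (Set.range squareCylinder) := by
    ext σ
    simp [induced]
  rw [huniv] at h0
  exact hne h0
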